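/- **Setting.** Let $D$ be a non-empty, locally compact subset of some Euclidean space $\mathbb R^d$, and let $\mathrm{USC}(D)$ be the set of upper semicontinuous (usc) functions $z : D \to [-\infty,\infty]$, identified with their hypographs $\{(s,\alpha) \in D \times \mathbb R : \alpha \le z(s)\}$ and given the hypo-topology (the trace of the Fell topology on the closed subsets of $D \times \mathbb R$) and its Borel $\sigma$-field. A *usc process* on a probability space $(\Omega, \mathcal A, P)$ is a map $\xi : \Omega \times D \to [-\infty,\infty]$ with usc trajectories such that $\omega \mapsto \xi(\omega,\cdot)$ is a Borel measurable map from $\Omega$ to $\mathrm{USC}(D)$. Its law is a probability measure on $\mathrm{USC}(D)$. Functions $a_n : D \to (0,\infty)$ and $b_n : D \to \mathbb R$ are *normalizing functions* of order $n \ge 1$ for the usc process $\xi$ if $a_n \xi + b_n$ is a usc process and, for all iid usc processes $\xi_1, \dots, \xi_n$ with the same law as $\xi$, the processes $\xi_1 \vee \dots \vee \xi_n$ and $a_n \xi + b_n$ have the same law on $\mathrm{USC}(D)$. A usc process is *max-stable* if it has normalizing functions of every order $n \ge 1$. A max-stable usc process $\xi^*$ is *simple* if its margins are unit-Fréchet,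 that is, $P[\xi^*(s) \le x] = \Phi(x)$ for every $s \in D$, where $\Phi(x) = 0$ for $x \le 0$, $\Phi(x) = e^{-1/x}$ for $0 < x < \infty$, and $\Phi(\infty) = 1$. For $\theta = (\gamma,\mu,\sigma) \in \Theta = \mathbb R \times \mathbb R \times (0,\infty)$, the distribution function of $\mathrm{GEV}(\theta)$ is, for $x \in \mathbb R$, $$F(x;\theta) = \begin{cases} \exp[-\{1+\gamma(x-\mu)/\sigma\}^{-1/\gamma}] & \text{if } \gamma \ne 0,\ \sigma + \gamma(x-\mu) > 0,\\ 0 & \text{if } \gamma > 0,\ \sigma + \gamma(x-\mu) \le 0,\\ 1 & \text{if } \gamma < 0,\ \sigma + \gamma(x-\mu) \le 0,\\ \exp[-\exp\{-(x-\mu)/\sigma\}] & \text{if } \gamma = 0,\end{cases}$$ with $F(-\infty;\theta) = 0$ and $F(\infty;\theta) = 1$. Its right-continuous quantile function is $Q(p;\theta) = \sup\{x \in \mathbb R : F(x;\theta) \le p\} \in [-\infty,\infty]$ for $p \in [0,1]$, where $\sup\varnothing = -\infty$ and $\sup\mathbb R = \infty$. For $n \ge 1$ let $$a_{n,\theta}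 = n^\gamma, \qquad b_{n,\theta} = \begin{cases} (\sigma-\gamma\mu)(n^\gamma-1)/\gamma & \text{if } \gamma \ne 0,\\ \sigma \log n & \text{if } \gamma = 0.\end{cases}$$ **Proposition.** Let $\xi^*$ be a simple max-stable usc process on $D$ and let $\theta : D \to \Theta$ be an arbitrary function. Put $\xi(s) = Q(\Phi(\xi^*(s)); \theta(s))$ for $s \in D$. Then the following two statements are equivalent: 1. $\xi$ is a usc process and $P[\xi(s) \le x] = F(x;\theta(s))$ for all $s \in D$ and $x \in [-\infty,\infty]$; 2. for every $p \in [0,1]$, the function $s \mapsto Q(p;\theta(s))$ is usc on $D$. If these conditions hold, then $\xi$ is a max-stable usc process, and for every $n \ge 1$ the functions $s \mapsto a_{n,\theta(s)}$ and $s \mapsto b_{n,\theta(s)}$ are normalizing functions of order $n$ for $\xi$. -/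

import Mathlib

open MeasureTheory ProbabilityTheory Set
open scoped Topology

noncomputable section

/-! ### Upper semicontinuous functions and the hypo-topology -/

/-- The Fell hit-and-miss topology on the closed subsets of `S`: it is generated by the sets
`{F | F ∩ K = ∅}` with `K` compact and `{F | F ∩ G ≠ ∅}` with `G` open. Finite intersections of
these are the sets `{F | F ∩ K = ∅, F ∩ G₁ ≠ ∅, …, F ∩ Gₙ ≠ ∅}`. -/
@[reducible] def fellTopology (S : Type) [TopologicalSpace S] :
    TopologicalSpace (TopologicalSpace.Closeds S) :=
  TopologicalSpace.generateFrom
    ({A | ∃ K : Set S, IsCompact K ∧ A = {F | F.carrier ∩ K = ∅}} ∪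
      {A | ∃ G : Set S, IsOpen G ∧ A = {F | (F.carrier ∩ G).Nonempty}})

/-- `USC(D)`: the upper semicontinuous functions from `D` to `[-∞, ∞]`. -/
structure USCFun (D : Type) [TopologicalSpace D] where
  toFun : D → EReal
  usc' : UpperSemicontinuous toFun

instance USCFun.instCoeFun (D : Type) [TopologicalSpace D] :
    CoeFun (USCFun D) (fun _ => D → EReal) :=
  ⟨USCFun.toFun⟩

/-- The hypograph `{(s, α) ∈ D × ℝ | α ≤ z s}`, a closed subset of `D × ℝ`. -/
def USCFun.hypo {D : Type} [TopologicalSpace D] (z : USCFun D) :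
    TopologicalSpace.Closeds (D × ℝ) where
  carrier := {q | (q.2 : EReal) ≤ z q.1}
  isClosed' := z.usc'.IsClosed_hypograph.preimage
    (continuous_fst.prodMk (continuous_coe_real_ereal.comp continuous_snd))

/-- The hypo-topology: the trace of the Fell topology under `z ↦ hypo z`. -/
instance USCFun.instTopologicalSpace (D : Type) [TopologicalSpace D] :
    TopologicalSpace (USCFun D) :=
  TopologicalSpace.induced USCFun.hypo (fellTopology (D × ℝ))

/-- The σ-field of hypo-measurable sets. -/
instance USCFun.instMeasurableSpace (D : Type) [TopologicalSpace D] :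
    MeasurableSpace (USCFun D) :=
  borel (USCFun D)

/-- The pointwise maximum of finitely many upper semicontinuous functions. -/
def USCFun.finMax {D : Type} [TopologicalSpace D] {n : ℕ} (z : Fin n → USCFun D) : USCFun D where
  toFun := fun s => Finset.univ.sup (fun i => z i s)
  usc' := by
    have key : ∀ t : Finset (Fin n), UpperSemicontinuous (fun s => t.sup (fun i => z i s)) := by
      intro t
      classical
      induction t using Finset.induction_on with
      | empty => simpa using upperSemicontinuous_const
      | insert i t _ ih =>
        simp only [Finset.sup_insert]
        exact (z i).usc'.sup ih
    exact key _

/-! ### usc processes and max-stability -/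

/-- `X : Ω → USC(D)` is a hypo-measurable map whose value at `ω` is the trajectory `ξ ω`. -/
def IsRandomUSC {D : Type} [TopologicalSpace D] {Ω : Type*} [MeasurableSpace Ω]
    (ξ : Ω → D → EReal) (X : Ω → USCFun D) : Prop :=
  Measurable X ∧ ∀ ω s, X ω s = ξ ω s

/-- `ξ` is a usc process: its trajectories are usc and `ω ↦ ξ ω` is a Borel measurable map into
`USC(D)` with the hypo-topology. -/
def IsUSCProcess {D : Type} [TopologicalSpace D] {Ω : Type*} [MeasurableSpace Ω]
    (ξ : Ω → D → EReal) : Prop :=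
  ∃ X : Ω → USCFun D, IsRandomUSC ξ X

/-- `a : D → (0, ∞)` and `b : D → ℝ` are norming functions of order `n` for the usc process `ξ`:
`a ξ + b` is a usc process, and for all iid usc processes `ξ₁, …, ξₙ` with the same law as `ξ`,
on any probability space, `ξ₁ ∨ ⋯ ∨ ξₙ` and `a ξ + b` have the same law on `USC(D)`. -/
def IsNorming {D : Type} [TopologicalSpace D] {Ω : Type*} [MeasurableSpace Ω]
    (P : Measure Ω) (ξ : Ω → D → EReal) (n : ℕ) (a b : D → ℝ) : Prop :=
  (∀ s, 0 < a s) ∧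
  ∃ X Y : Ω → USCFun D,
    IsRandomUSC ξ X ∧
    IsRandomUSC (fun ω s => (a s : EReal) * ξ ω s + (b s : EReal)) Y ∧
    ∀ (Ω' : Type) [MeasurableSpace Ω'] (P' : Measure Ω') [IsProbabilityMeasure P']
      (X' : Fin n → Ω' → USCFun D),
      (∀ i, Measurable (X' i)) → iIndepFun X' P' → (∀ i, IdentDistrib (X' i) X P' P) →
      IdentDistrib (fun ω => USCFun.finMax (fun i => X' i ω)) Y P' P

/-- Max-stability of a usc process, with norming functions that may depend on `s`. -/
def IsMaxStable {D : Type} [TopologicalSpace D] {Ω : Type*} [MeasurableSpace Ω]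
    (P : Measure Ω) (ξ : Ω → D → EReal) : Prop :=
  IsUSCProcess ξ ∧ ∀ n : ℕ, 1 ≤ n → ∃ a b : D → ℝ, IsNorming P ξ n a b

/-! ### Generalized extreme-value distributions -/

/-- The parameter set `Θ = ℝ × ℝ × (0, ∞)` of triples `(γ, μ, σ)`. -/
structure GEVParam where
  γ : ℝ
  μ : ℝ
  σ : ℝ
  σ_pos : 0 < σ

/-- The `GEV(θ)` distribution function on `ℝ`; off the support it is `0` (below the lower endpoint,
`γ > 0`) or `1` (above the upper endpoint, `γ < 0`). -/
def gevCDFReal (θ : GEVParam) (x : ℝ) : ℝ :=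
  if θ.γ = 0 then Real.exp (-Real.exp (-(x - θ.μ) / θ.σ))
  else if 0 < θ.σ + θ.γ * (x - θ.μ) then
    Real.exp (-(1 + θ.γ * (x - θ.μ) / θ.σ) ^ (-1 / θ.γ))
  else if 0 < θ.γ then 0 else 1

/-- The `GEV(θ)` distribution function on `[-∞, ∞]`. -/
def gevCDF (θ : GEVParam) (x : EReal) : ℝ :=
  if x = ⊥ then 0 else if x = ⊤ then 1 else gevCDFReal θ x.toReal

/-- The right-continuous quantile function `Q(p; θ) = sup {x ∈ ℝ | F(x; θ) ≤ p}` of `GEV(θ)`, with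
`sup ∅ = -∞` and `sup ℝ = ∞`. -/
def gevQuantile (p : ℝ) (θ : GEVParam) : EReal :=
  sSup ((fun x : ℝ => (x : EReal)) '' {x : ℝ | gevCDFReal θ x ≤ p})

/-- The parameter `(1, 1, 1)` of the unit-Fréchet distribution. -/
def unitFrechetParam : GEVParam := ⟨1, 1, 1, one_pos⟩

/-- The unit-Fréchet distribution function `Φ` on `[-∞, ∞]`. -/
def unitFrechet (x : EReal) : ℝ := gevCDF unitFrechetParam x

theorem unitFrechet_coe (x : ℝ) :
    unitFrechet (x : EReal) = if x ≤ 0 then 0 else Real.exp (-1 / x) := by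
  by_cases h : x ≤ 0
  · simp [unitFrechet, gevCDF, gevCDFReal, unitFrechetParam, h]
  · simp [unitFrechet, gevCDF, gevCDFReal, unitFrechetParam, h, not_le.mp h, Real.rpow_neg_one,
      neg_div]

/-- The margins of `ξ` are `GEV(θ(s))`. -/
def HasGEVMargins {D Ω : Type*} [MeasurableSpace Ω] (P : Measure Ω) (ξ : Ω → D → EReal)
    (θ : D → GEVParam) : Prop :=
  ∀ (s : D) (x : EReal), P {ω | ξ ω s ≤ x} = ENNReal.ofReal (gevCDF (θ s) x)

/-- A simple max-stable usc process: max-stable with unit-Fréchet margins. -/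
def IsSimpleMaxStable {D : Type} [TopologicalSpace D] {Ω : Type*} [MeasurableSpace Ω]
    (P : Measure Ω) (ξ : Ω → D → EReal) : Prop :=
  IsMaxStable P ξ ∧ HasGEVMargins P ξ (fun _ => unitFrechetParam)

/-- The scale constants `a_{n,θ} = n ^ γ`. -/
def gevScale (n : ℕ) (θ : GEVParam) : ℝ := (n : ℝ) ^ θ.γ

/-- The location constants `b_{n,θ}`. -/
def gevLoc (n : ℕ) (θ : GEVParam) : ℝ :=
  if θ.γ = 0 then θ.σ * Real.log n
  else (θ.σ - θ.γ * θ.μ) * ((n : ℝ) ^ θ.γ - 1) / θ.γ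

end

/-! ### The GEV distribution function -/

/-! Since F(·;θ) is continuous and nondecreasing, Q(p;θ) < a holds exactly when p < F(a;θ). Usc of
all the quantile functions is therefore lower semicontinuity of s ↦ F(a;θ(s)) for every real a
(`upperSemicontinuous_gevQuantile_iff`), and the argument runs with the latter.

If ξ has usc trajectories, P[ξ(s) < a] = F(a;θ(s)), and continuity from below of P transfers the
semicontinuity of the paths to F. Conversely, lower semicontinuity makes T : z ↦ Q(Φ(z(·));θ(·)) a
map of USC(D) into itself that pulls each event "below a on a compact set" back to an open set.
These events determine measurability into USC(D), so T is Borel; the margins follow because Φ(ξ*(s))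
is uniform.

For max-stability, T commutes with finite nonempty maxima because it is nondecreasing at each point,
the norming functions of ξ* can only be n and 0, and F(a_n y + b_n)^n = F(y) gives T(nz) = a_n T(z)
+ b_n. Hence the maximum of n copies of Tξ* has the law of T(nξ*) = a_n ξ + b_n. -/

theorem gevCDFReal_of_zero {θ : GEVParam} (h : θ.γ = 0) (x : ℝ) :
    gevCDFReal θ x = Real.exp (-Real.exp (-(x - θ.μ) / θ.σ)) := by
  simp [gevCDFReal, h]

theorem gev_support_iff (θ : GEVParam) (x : ℝ) :
    0 < θ.σ + θ.γ * (x - θ.μ) ↔ 0 < 1 + θ.γ * (x - θ.μ) / θ.σ := by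
  have hσ := θ.σ_pos
  rw [show 1 + θ.γ * (x - θ.μ) / θ.σ = (θ.σ + θ.γ * (x - θ.μ)) / θ.σ by field_simp]
  exact (div_pos_iff_of_pos_right hσ).symm

/-- Taking the positive part absorbs the case split at the endpoint, so continuity and monotonicity
become facts about compositions. `expNegInvGlue` is exp(-1/x) extended by 0 to x ≤ 0. -/
theorem gevCDFReal_of_pos {θ : GEVParam} (h : 0 < θ.γ) (x : ℝ) :
    gevCDFReal θ x =
      expNegInvGlue ((max (1 + θ.γ * (x - θ.μ) / θ.σ) 0) ^ (1 / θ.γ)) := by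
  unfold gevCDFReal
  simp only [if_neg h.ne', gev_support_iff]
  split_ifs with h1
  · have h2 : 0 < (1 + θ.γ * (x - θ.μ) / θ.σ) ^ (1 / θ.γ) := Real.rpow_pos_of_pos h1 _
    rw [max_eq_left h1.le, expNegInvGlue, if_neg h2.not_ge, ← Real.rpow_neg h1.le, neg_div]
  · rw [max_eq_right (not_lt.mp h1), Real.zero_rpow (by positivity), expNegInvGlue.zero]

theorem gevCDFReal_of_neg {θ : GEVParam} (h : θ.γ < 0) (x : ℝ) :
    gevCDFReal θ x = Real.exp (-(max (1 + θ.γ * (x - θ.μ) / θ.σ) 0) ^ (-1 / θ.γ)) := by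
  unfold gevCDFReal
  simp only [if_neg h.ne, gev_support_iff]
  have : 0 < -1 / θ.γ := div_pos_of_neg_of_neg (by norm_num) h
  split_ifs with h1
  · rw [max_eq_left h1.le]
  · exact absurd h (not_lt.mpr (by assumption : 0 < θ.γ).le)
  · rw [max_eq_right (not_lt.mp h1), Real.zero_rpow this.ne', neg_zero, Real.exp_zero]

theorem expNegInvGlue_mono : Monotone expNegInvGlue := by
  intro x y hxy
  rcases le_or_gt x 0 with hx | hx
  · rw [expNegInvGlue.zero_of_nonpos hx]; exact expNegInvGlue.nonneg y
  · rw [expNegInvGlue, expNegInvGlue, if_neg hx.not_ge, if_neg (hx.trans_le hxy).not_ge]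
    gcongr

theorem continuous_gevCDFReal (θ : GEVParam) : Continuous (gevCDFReal θ) := by
  rcases lt_trichotomy θ.γ 0 with h | h | h
  · have : 0 < -1 / θ.γ := div_pos_of_neg_of_neg (by norm_num) h
    rw [funext (gevCDFReal_of_neg h)]
    refine Real.continuous_exp.comp (Continuous.neg ?_)
    exact Continuous.rpow_const (by fun_prop) fun _ => Or.inr this.le
  · rw [funext (gevCDFReal_of_zero h)]
    fun_prop
  · rw [funext (gevCDFReal_of_pos h)]
    refine (expNegInvGlue.contDiff (n := 0)).continuous.comp ?_
    exact Continuous.rpow_const (by fun_prop) fun _ => Or.inr (by positivity)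

theorem monotone_gevCDFReal (θ : GEVParam) : Monotone (gevCDFReal θ) := by
  intro x y hxy
  have hσ := θ.σ_pos
  rcases lt_trichotomy θ.γ 0 with h | h | h
  · have : 0 < -1 / θ.γ := div_pos_of_neg_of_neg (by norm_num) h
    rw [gevCDFReal_of_neg h, gevCDFReal_of_neg h]
    refine Real.exp_le_exp.mpr (neg_le_neg ?_)
    refine Real.rpow_le_rpow (le_max_right _ _) (max_le_max_right _ ?_) this.le
    have : θ.γ * (y - θ.μ) ≤ θ.γ * (x - θ.μ) :=
      mul_le_mul_of_nonpos_left (by linarith) h.le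
    gcongr
  · rw [gevCDFReal_of_zero h, gevCDFReal_of_zero h]
    gcongr
  · rw [gevCDFReal_of_pos h, gevCDFReal_of_pos h]
    refine expNegInvGlue_mono (Real.rpow_le_rpow (le_max_right _ _) (max_le_max_right _ ?_) ?_)
    · gcongr
    · positivity

theorem gevCDFReal_nonneg (θ : GEVParam) (x : ℝ) : 0 ≤ gevCDFReal θ x := by
  unfold gevCDFReal
  split_ifs <;> positivity

theorem gevCDFReal_le_one (θ : GEVParam) (x : ℝ) : gevCDFReal θ x ≤ 1 := by
  unfold gevCDFReal
  split_ifs with h1 h2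
  · exact Real.exp_le_one_iff.mpr (neg_nonpos.mpr (Real.exp_pos _).le)
  · exact Real.exp_le_one_iff.mpr
      (neg_nonpos.mpr (Real.rpow_nonneg ((gev_support_iff θ x).mp h2).le _))
  · exact zero_le_one
  · exact le_rfl

theorem tendsto_gevCDFReal_atBot (θ : GEVParam) :
    Filter.Tendsto (gevCDFReal θ) Filter.atBot (𝓝 0) := by
  have hσ := θ.σ_pos
  have hsub : Filter.Tendsto (fun x : ℝ => x - θ.μ) Filter.atBot Filter.atBot := by
    simpa [sub_eq_add_neg] using Filter.tendsto_atBot_add_const_right Filter.atBot (-θ.μ)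
      Filter.tendsto_id
  rcases lt_trichotomy θ.γ 0 with h | h | h
  · have h0 : 0 < -1 / θ.γ := div_pos_of_neg_of_neg (by norm_num) h
    rw [funext (gevCDFReal_of_neg h)]
    refine Real.tendsto_exp_neg_atTop_nhds_zero.comp ((tendsto_rpow_atTop h0).comp ?_)
    refine Filter.tendsto_atTop_mono (fun _ => le_max_left _ _) ?_
    refine Filter.tendsto_atTop_add_const_left _ _ (Filter.Tendsto.atTop_div_const hσ ?_)
    exact hsub.const_mul_atBot_of_neg h
  · rw [funext (gevCDFReal_of_zero h)]
    refine Real.tendsto_exp_neg_atTop_nhds_zero.comp (Real.tendsto_exp_atTop.comp ?_)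
    exact (Filter.tendsto_neg_atBot_atTop.comp hsub).atTop_div_const hσ
  · have h2 : ∀ᶠ x in Filter.atBot, θ.γ * (x - θ.μ) ≤ -θ.σ :=
      (hsub.const_mul_atBot h).eventually (Filter.eventually_le_atBot (-θ.σ))
    refine tendsto_const_nhds.congr' ?_
    filter_upwards [h2] with x hx
    have h3 : ¬ 0 < θ.σ + θ.γ * (x - θ.μ) := by linarith
    simp [gevCDFReal, h.ne', h3, h]

theorem gevCDF_coe (θ : GEVParam) (x : ℝ) : gevCDF θ (x : EReal) = gevCDFReal θ x := by
  simp [gevCDF]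

theorem gevCDF_bot (θ : GEVParam) : gevCDF θ ⊥ = 0 := by simp [gevCDF]

theorem gevCDF_top (θ : GEVParam) : gevCDF θ ⊤ = 1 := by simp [gevCDF]

theorem gevCDF_nonneg (θ : GEVParam) (x : EReal) : 0 ≤ gevCDF θ x := by
  induction x with
  | bot => rw [gevCDF_bot]
  | top => rw [gevCDF_top]; exact zero_le_one
  | coe x => rw [gevCDF_coe]; exact gevCDFReal_nonneg θ x

theorem gevCDF_le_one (θ : GEVParam) (x : EReal) : gevCDF θ x ≤ 1 := by
  induction x with
  | bot => rw [gevCDF_bot]; exact zero_le_one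
  | top => rw [gevCDF_top]
  | coe x => rw [gevCDF_coe]; exact gevCDFReal_le_one θ x

theorem monotone_gevCDF (θ : GEVParam) : Monotone (gevCDF θ) := by
  intro x y hxy
  induction x with
  | bot => rw [gevCDF_bot]; exact gevCDF_nonneg θ y
  | top => rw [top_le_iff.mp hxy]
  | coe x =>
    induction y with
    | bot => simp at hxy
    | top => rw [gevCDF_top]; exact gevCDF_le_one θ _
    | coe y =>
      rw [gevCDF_coe, gevCDF_coe]
      exact monotone_gevCDFReal θ (EReal.coe_le_coe_iff.mp hxy)

/-! ### Quantile functions -/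

/-- Continuity is what makes the supremum behave as if attained: if F(a) > p, then F(b) > p for some
b < a, and monotonicity makes b an upper bound of the set defining Q. -/
theorem coe_le_gevQuantile_iff (θ : GEVParam) (p a : ℝ) :
    (a : EReal) ≤ gevQuantile p θ ↔ gevCDFReal θ a ≤ p := by
  refine ⟨fun h => ?_, fun h => le_sSup ⟨a, h, rfl⟩⟩
  by_contra! hp
  obtain ⟨b, hb, hba⟩ : ∃ b, p < gevCDFReal θ b ∧ b < a :=
    (((continuous_gevCDFReal θ).continuousAt.continuousWithinAt.eventually
      (lt_mem_nhds hp)).and (self_mem_nhdsWithin (s := Iio a))).exists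
  have : gevQuantile p θ ≤ (b : EReal) := by
    refine sSup_le ?_
    rintro _ ⟨x, hx, rfl⟩
    refine EReal.coe_le_coe_iff.mpr (le_of_not_gt fun hbx => ?_)
    exact absurd (hb.trans_le (monotone_gevCDFReal θ hbx.le)) (not_lt.mpr hx)
  exact absurd (h.trans this) (not_le.mpr (EReal.coe_lt_coe_iff.mpr hba))

theorem gevQuantile_lt_coe_iff (θ : GEVParam) (p a : ℝ) :
    gevQuantile p θ < (a : EReal) ↔ p < gevCDFReal θ a := by
  rw [← not_le, coe_le_gevQuantile_iff, not_le]

theorem monotone_gevQuantile (θ : GEVParam) : Monotone fun p => gevQuantile p θ :=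
  fun _ _ hpq => sSup_le_sSup (image_mono fun _ hx => le_trans hx hpq)

theorem upperSemicontinuous_gevQuantile_iff {D : Type*} [TopologicalSpace D]
    (θ : D → GEVParam) :
    (∀ p ∈ Set.Icc (0 : ℝ) 1, UpperSemicontinuous fun s => gevQuantile p (θ s)) ↔
      ∀ a : ℝ, LowerSemicontinuous fun s => gevCDFReal (θ s) a := by
  constructor
  · intro h a s p hp
    -- Only levels in [0,1] are available; a negative level is trivial, and p < F ≤ 1 bounds the
    -- others.
    rcases lt_or_ge p 0 with h0 | h0
    · exact Filter.Eventually.of_forall fun s' => h0.trans_le (gevCDFReal_nonneg _ _)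
    · have := h p ⟨h0, hp.le.trans (gevCDFReal_le_one _ _)⟩ s a
        ((gevQuantile_lt_coe_iff _ _ _).mpr hp)
      exact this.mono fun s' hs' => (gevQuantile_lt_coe_iff _ _ _).mp hs'
  · intro h p _ s y hy
    obtain ⟨a, ha, hay⟩ := EReal.lt_iff_exists_real_btwn.mp hy
    exact (h a s p ((gevQuantile_lt_coe_iff _ _ _).mp ha)).mono fun s' hs' =>
      ((gevQuantile_lt_coe_iff _ _ _).mpr hs').trans hay

/-! ### Norming constants -/

theorem gevScale_pos {n : ℕ} (hn : 1 ≤ n) (θ : GEVParam) : 0 < gevScale n θ :=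
  Real.rpow_pos_of_pos (by exact_mod_cast hn) _

/-- GEV distributions are max-stable. -/
theorem gevCDFReal_scale_add_loc_pow {n : ℕ} (hn : 1 ≤ n) (θ : GEVParam) (y : ℝ) :
    gevCDFReal θ (gevScale n θ * y + gevLoc n θ) ^ n = gevCDFReal θ y := by
  have hσ := θ.σ_pos
  have hn0 : (0 : ℝ) < n := by exact_mod_cast hn
  by_cases h : θ.γ = 0
  · rw [gevCDFReal_of_zero h, gevCDFReal_of_zero h, ← Real.exp_nat_mul]
    congr 1
    have : -(gevScale n θ * y + gevLoc n θ - θ.μ) / θ.σ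
        = -(y - θ.μ) / θ.σ - Real.log n := by
      simp only [gevScale, gevLoc, h, if_true, Real.rpow_zero]
      field_simp
      ring
    rw [this, Real.exp_sub, Real.exp_log hn0]
    field_simp
  · have hs : 0 < (n : ℝ) ^ θ.γ := Real.rpow_pos_of_pos hn0 _
    -- The constants rescale the support expression by n^γ. Its power -1/γ is then divided by n,
    -- which the n-th power of F undoes.
    have key : θ.σ + θ.γ * (gevScale n θ * y + gevLoc n θ - θ.μ)
        = (n : ℝ) ^ θ.γ * (θ.σ + θ.γ * (y - θ.μ)) := by
      simp only [gevScale, gevLoc, h, if_false]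
      field_simp
      ring
    have key' : 1 + θ.γ * (gevScale n θ * y + gevLoc n θ - θ.μ) / θ.σ
        = (n : ℝ) ^ θ.γ * (1 + θ.γ * (y - θ.μ) / θ.σ) := by
      rw [show ∀ t : ℝ, 1 + t / θ.σ = (θ.σ + t) / θ.σ by intro t; field_simp, key]
      field_simp
    unfold gevCDFReal
    simp only [h, if_false, key, key', mul_pos_iff_of_pos_left hs]
    split_ifs with h1
    · have h2 := (gev_support_iff θ y).mp h1
      rw [← Real.exp_nat_mul, Real.mul_rpow hs.le h2.le, ← Real.rpow_mul hn0.le,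
        mul_div_cancel₀ _ h, Real.rpow_neg_one]
      congr 1
      field_simp
    · exact zero_pow (by omega)
    · exact one_pow n

theorem unitFrechet_natCast_mul_pow {n : ℕ} (hn : 1 ≤ n) (x : EReal) :
    unitFrechet (((n : ℝ) : EReal) * x) ^ n = unitFrechet x := by
  have hn0 : (0 : ℝ) < n := by exact_mod_cast hn
  unfold unitFrechet
  induction x with
  | bot => rw [EReal.coe_mul_bot_of_pos hn0, gevCDF_bot, zero_pow (by omega)]
  | top => rw [EReal.coe_mul_top_of_pos hn0, gevCDF_top, one_pow]
  | coe x =>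
    rw [← EReal.coe_mul, gevCDF_coe, gevCDF_coe,
      ← gevCDFReal_scale_add_loc_pow hn unitFrechetParam x]
    simp [gevScale, gevLoc, unitFrechetParam]

theorem coe_le_mul_add_iff {a : ℝ} (ha : 0 < a) (b x : ℝ) (z : EReal) :
    ((a * x + b : ℝ) : EReal) ≤ (a : EReal) * z + (b : EReal) ↔ (x : EReal) ≤ z := by
  induction z with
  | bot => rw [EReal.coe_mul_bot_of_pos ha, EReal.bot_add]; simp only [le_bot_iff, EReal.coe_ne_bot]
  | top => rw [EReal.coe_mul_top_of_pos ha]; simp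
  | coe z => norm_cast; rw [add_le_add_iff_right, mul_le_mul_iff_right₀ ha]

theorem EReal.eq_of_forall_coe_le_iff {x y : EReal}
    (h : ∀ a : ℝ, (a : EReal) ≤ x ↔ (a : EReal) ≤ y) :
    x = y := by
  refine le_antisymm ?_ ?_
  · refine le_of_forall_lt fun c hc => ?_
    obtain ⟨a, hca, hax⟩ := EReal.lt_iff_exists_real_btwn.mp hc
    exact hca.trans_le ((h a).mp hax.le)
  · refine le_of_forall_lt fun c hc => ?_
    obtain ⟨a, hca, hax⟩ := EReal.lt_iff_exists_real_btwn.mp hc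
    exact hca.trans_le ((h a).mpr hax.le)

/-- Both sides dominate the same reals a_n y + b_n: the conditions are F(y) ≤ Φ(z) and F(a_n y +
b_n) ≤ Φ(nz), and the first is the n-th power of the second. -/
theorem gevScale_mul_gevQuantile_add_gevLoc {n : ℕ} (hn : 1 ≤ n) (θ : GEVParam) (z : EReal) :
    (gevScale n θ : EReal) * gevQuantile (unitFrechet z) θ + (gevLoc n θ : EReal)
      = gevQuantile (unitFrechet (((n : ℝ) : EReal) * z)) θ := by
  have ha := gevScale_pos hn θ
  refine EReal.eq_of_forall_coe_le_iff fun x => ?_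
  obtain ⟨y, rfl⟩ : ∃ y, gevScale n θ * y + gevLoc n θ = x :=
    ⟨(x - gevLoc n θ) / gevScale n θ, by field_simp; ring⟩
  rw [coe_le_mul_add_iff ha, coe_le_gevQuantile_iff, coe_le_gevQuantile_iff,
    ← gevCDFReal_scale_add_loc_pow hn θ y, ← unitFrechet_natCast_mul_pow hn z]
  exact pow_le_pow_iff_left₀ (gevCDFReal_nonneg _ _) (gevCDF_nonneg _ _) (by omega)

/-! ### The Borel σ-field of the hypo-topology -/

theorem USCFun.ext_apply {D : Type} [TopologicalSpace D] {z w : USCFun D}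
    (h : ∀ s, z s = w s) : z = w := by
  cases z; cases w
  congr
  exact funext h

instance USCFun.instBorelSpace (D : Type) [TopologicalSpace D] : BorelSpace (USCFun D) := ⟨rfl⟩

theorem USCFun.isOpen_disjoint_hypo {D : Type} [TopologicalSpace D] {K : Set (D × ℝ)}
    (hK : IsCompact K) : IsOpen {z : USCFun D | z.hypo.carrier ∩ K = ∅} := by
  let := fellTopology (D × ℝ)
  have h : IsOpen {F : TopologicalSpace.Closeds (D × ℝ) | F.carrier ∩ K = ∅} :=
    TopologicalSpace.isOpen_generateFrom_of_mem (Or.inl ⟨K, hK, rfl⟩)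
  exact isOpen_induced (f := USCFun.hypo) h

theorem USCFun.isOpen_inter_hypo_nonempty {D : Type} [TopologicalSpace D] {G : Set (D × ℝ)}
    (hG : IsOpen G) : IsOpen {z : USCFun D | (z.hypo.carrier ∩ G).Nonempty} := by
  let := fellTopology (D × ℝ)
  have h : IsOpen {F : TopologicalSpace.Closeds (D × ℝ) | (F.carrier ∩ G).Nonempty} :=
    TopologicalSpace.isOpen_generateFrom_of_mem (Or.inr ⟨G, hG, rfl⟩)
  exact isOpen_induced (f := USCFun.hypo) h

/-- This is the Fell miss set of the compact set K × {a}. -/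
theorem USCFun.isOpen_forall_lt {D : Type} [TopologicalSpace D] {K : Set D} (hK : IsCompact K)
    (a : ℝ) : IsOpen {z : USCFun D | ∀ s ∈ K, z s < a} := by
  convert USCFun.isOpen_disjoint_hypo (hK.prod (isCompact_singleton (x := a))) using 1
  ext z
  simp only [mem_ofPred_eq, eq_empty_iff_forall_notMem, Prod.forall, mem_inter_iff, mem_prod,
    mem_singleton_iff, USCFun.hypo, not_and]
  constructor
  · rintro h s b hb hs rfl
    exact absurd (h s hs) (not_lt.mpr hb)
  · exact fun h s hs => lt_of_not_ge fun hle => h s a hle hs rfl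

theorem USCFun.isOpen_exists_gt {D : Type} [TopologicalSpace D] {V : Set D} (hV : IsOpen V)
    (a : ℝ) : IsOpen {z : USCFun D | ∃ s ∈ V, (a : EReal) < z s} := by
  convert USCFun.isOpen_inter_hypo_nonempty (hV.prod (isOpen_Ioi (a := a))) using 1
  ext z
  constructor
  · rintro ⟨s, hs, h⟩
    obtain ⟨b, hab, hb⟩ := EReal.lt_iff_exists_real_btwn.mp h
    exact ⟨(s, b), hb.le, hs, EReal.coe_lt_coe_iff.mp hab⟩
  · rintro ⟨⟨s, b⟩, hb, hs, hab⟩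
    exact ⟨s, hs, (EReal.coe_lt_coe_iff.mpr hab).trans_le hb⟩

/-- A strict pointwise upper bound on a compact set, given by a relation that is open and
downward closed, defines an open set. -/
theorem USCFun.isOpen_forall_rel {D : Type} [TopologicalSpace D] [LocallyCompactSpace D]
    {K : Set D} (hK : IsCompact K) {R : D → EReal → Prop}
    (hR : ∀ s x, R s x → ∃ q : ℝ, x < q ∧ ∀ᶠ s' in 𝓝 s, ∀ y < (q : EReal), R s' y) :
    IsOpen {z : USCFun D | ∀ s ∈ K, R s (z s)} := by
  refine isOpen_iff_mem_nhds.mpr fun z hz => ?_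
  refine hK.induction_on (p := fun t => {w : USCFun D | ∀ s ∈ t, R s (w s)} ∈ 𝓝 z)
    (by simp) (fun s t hst ht => ?_) (fun s t hs ht => ?_) (fun s hs => ?_)
  · exact Filter.mem_of_superset ht fun w hw s' hs' => hw s' (hst hs')
  · filter_upwards [hs, ht] with w hws hwt s' hs'
    exact hs'.elim (hws s') (hwt s')
  -- Locally, R follows from the single bound w < q on a compact neighborhood N, an open condition
  -- on w that z satisfies.
  · obtain ⟨q, hq, hev⟩ := hR s (z s) (hz s hs)
    obtain ⟨N, hN, hsub, hNc⟩ := local_compact_nhds ((z.usc' s q hq).and hev)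
    refine ⟨N, mem_nhdsWithin_of_mem_nhds hN, ?_⟩
    refine Filter.mem_of_superset ((USCFun.isOpen_forall_lt hNc q).mem_nhds fun s' hs' =>
      (hsub hs').1) fun w hw s' hs' => (hsub hs').2 _ (hw s' hs')

/-- The sets of functions that lie below `q` on the closure of `V`, for basic open sets `V` with
compact closure, and those that exceed `q` somewhere in `V`, for `q` rational. -/
def USCFun.countableSubbasis (D : Type) [TopologicalSpace D] [SecondCountableTopology D] :
    Set (Set (USCFun D)) :=
  {A | ∃ V ∈ TopologicalSpace.countableBasis D, ∃ q : ℚ, IsCompact (closure V) ∧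
      A = {z | ∀ s ∈ closure V, z s < ((q : ℝ) : EReal)}} ∪
    {A | ∃ V ∈ TopologicalSpace.countableBasis D, ∃ q : ℚ,
      A = {z | ∃ s ∈ V, ((q : ℝ) : EReal) < z s}}

theorem USCFun.countable_countableSubbasis (D : Type) [TopologicalSpace D]
    [SecondCountableTopology D] : (USCFun.countableSubbasis D).Countable := by
  have hB := TopologicalSpace.countable_countableBasis D
  refine Countable.union ?_ ?_
  · refine Countable.mono ?_ ((hB.prod (countable_univ (α := ℚ))).image
      fun v => {z : USCFun D | ∀ s ∈ closure v.1, z s < ((v.2 : ℝ) : EReal)})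
    rintro A ⟨V, hV, q, -, rfl⟩
    exact ⟨(V, q), ⟨hV, mem_univ _⟩, rfl⟩
  · refine Countable.mono ?_ ((hB.prod (countable_univ (α := ℚ))).image
      fun v => {z : USCFun D | ∃ s ∈ v.1, ((v.2 : ℝ) : EReal) < z s})
    rintro A ⟨V, hV, q, rfl⟩
    exact ⟨(V, q), ⟨hV, mem_univ _⟩, rfl⟩

theorem exists_countableBasis_closure_subset {D : Type*} [TopologicalSpace D]
    [LocallyCompactSpace D] [T2Space D] [SecondCountableTopology D] {s : D} {U : Set D}
    (hU : U ∈ 𝓝 s) :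
    ∃ V ∈ TopologicalSpace.countableBasis D, s ∈ V ∧ IsCompact (closure V) ∧ closure V ⊆ U := by
  obtain ⟨N, hN, hNU, hNc⟩ := local_compact_nhds hU
  obtain ⟨V, hV, hsV, hVN⟩ :=
    (TopologicalSpace.isBasis_countableBasis D).mem_nhds_iff.mp hN
  have hcl : closure V ⊆ N := closure_minimal hVN hNc.isClosed
  exact ⟨V, hV, hsV, hNc.of_isClosed_subset isClosed_closure hcl, hcl.trans hNU⟩

/-- A missed compact set is covered by finitely many boxes V × (q,∞) with z < q on the compact
closure of V. For hit sets, a small box inside G suffices because hypographs are closed downwards.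
-/
theorem USCFun.topology_eq_generateFrom (D : Type) [TopologicalSpace D] [LocallyCompactSpace D]
    [T2Space D] [SecondCountableTopology D] :
    USCFun.instTopologicalSpace D =
      TopologicalSpace.generateFrom (USCFun.countableSubbasis D) := by
  refine le_antisymm (le_generateFrom ?_) ?_
  · rintro A (⟨V, -, q, hVc, rfl⟩ | ⟨V, hV, q, rfl⟩)
    · exact USCFun.isOpen_forall_lt hVc q
    · exact USCFun.isOpen_exists_gt (TopologicalSpace.isOpen_of_mem_countableBasis hV) q
  · rw [USCFun.instTopologicalSpace, induced_generateFrom_eq]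
    let τ := TopologicalSpace.generateFrom (USCFun.countableSubbasis D)
    refine le_generateFrom ?_
    rintro _ ⟨_, (⟨K, hK, rfl⟩ | ⟨G, hG, rfl⟩), rfl⟩
    · refine isOpen_iff_mem_nhds.mpr fun z hz => ?_
      have hz' : ∀ x ∈ K, x ∉ z.hypo.carrier := fun x hx hxz =>
        (eq_empty_iff_forall_notMem.mp hz) x ⟨hxz, hx⟩
      suffices h : {w : USCFun D | ∀ x ∈ K, x ∉ w.hypo.carrier} ∈ 𝓝 z by
        refine Filter.mem_of_superset h fun w hw => ?_
        exact eq_empty_iff_forall_notMem.mpr fun x hx => hw x hx.2 hx.1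
      refine hK.induction_on (p := fun t => {w : USCFun D | ∀ x ∈ t, x ∉ w.hypo.carrier} ∈ 𝓝 z)
        (by simp) (fun s t hst ht => ?_) (fun s t hs ht => ?_) (fun x hx => ?_)
      · exact Filter.mem_of_superset ht fun w hw s' hs' => hw s' (hst hs')
      · filter_upwards [hs, ht] with w hws hwt s' hs'
        exact hs'.elim (hws s') (hwt s')
      · obtain ⟨s, b⟩ := x
        obtain ⟨q, hzq, hqb⟩ := EReal.lt_iff_exists_rat_btwn.mp (not_le.mp (hz' _ hx))
        obtain ⟨V, hV, hsV, hVc, hVU⟩ := exists_countableBasis_closure_subset (z.usc' s _ hzq)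
        refine ⟨V ×ˢ Ioi (q : ℝ), mem_nhdsWithin_of_mem_nhds (prod_mem_nhds
          ((TopologicalSpace.isOpen_of_mem_countableBasis hV).mem_nhds hsV)
          (Ioi_mem_nhds (EReal.coe_lt_coe_iff.mp hqb))), ?_⟩
        have ho : IsOpen {w : USCFun D | ∀ s ∈ closure V, w s < ((q : ℝ) : EReal)} :=
          TopologicalSpace.isOpen_generateFrom_of_mem (Or.inl ⟨V, hV, q, hVc, rfl⟩)
        refine Filter.mem_of_superset (ho.mem_nhds hVU) ?_
        rintro w hw ⟨s', b'⟩ ⟨hs', hb'⟩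
        exact not_le.mpr ((hw s' (subset_closure hs')).trans (EReal.coe_lt_coe_iff.mpr hb'))
    · refine isOpen_iff_mem_nhds.mpr ?_
      rintro z ⟨⟨s, b⟩, hb, hG'⟩
      obtain ⟨U, hU, W, hW, hUW⟩ := mem_nhds_prod_iff.mp (hG.mem_nhds hG')
      obtain ⟨V, hV, hsV, hVU⟩ :=
        (TopologicalSpace.isBasis_countableBasis D).mem_nhds_iff.mp hU
      obtain ⟨l, u, ⟨hl, hu⟩, hlu⟩ := mem_nhds_iff_exists_Ioo_subset.mp hW
      obtain ⟨q, hlq, hqb⟩ := exists_rat_btwn hl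
      have ho : IsOpen {w : USCFun D | ∃ s ∈ V, ((q : ℝ) : EReal) < w s} :=
        TopologicalSpace.isOpen_generateFrom_of_mem (Or.inr ⟨V, hV, q, rfl⟩)
      refine Filter.mem_of_superset
        (ho.mem_nhds ⟨s, hsV, (EReal.coe_lt_coe_iff.mpr hqb).trans_le hb⟩) ?_
      rintro w ⟨s', hs', hw⟩
      -- The value w s' may overshoot the box, so the hit point takes a height c below both w s' and
      -- u.
      obtain ⟨c, hqc, hcw⟩ := EReal.lt_iff_exists_real_btwn.mp
        (lt_min hw (EReal.coe_lt_coe_iff.mpr (hqb.trans hu)))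
      have h1 : (c : EReal) < w s' := hcw.trans_le (min_le_left _ _)
      have h2 : c < u := EReal.coe_lt_coe_iff.mp (hcw.trans_le (min_le_right _ _))
      have h3 : (q : ℝ) < c := EReal.coe_lt_coe_iff.mp hqc
      exact ⟨(s', c), h1.le, hUW ⟨hVU hs', hlu ⟨hlq.trans h3, h2⟩⟩⟩

/-- A map into `USC(D)` is measurable as soon as the events that it lies below a constant on a
compact set are measurable. -/
theorem USCFun.measurable_of_forall_lt {D : Type} [TopologicalSpace D] [LocallyCompactSpace D]
    [T2Space D] [SecondCountableTopology D] {α : Type*} [MeasurableSpace α] {f : α → USCFun D}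
    (hf : ∀ (K : Set D) (a : ℝ), IsCompact K → MeasurableSet {ω | ∀ s ∈ K, f ω s < a}) :
    Measurable f := by
  have hB := TopologicalSpace.countable_countableBasis D
  have := USCFun.topology_eq_generateFrom D
  have : SecondCountableTopology (USCFun D) :=
    ⟨USCFun.countableSubbasis D, USCFun.countable_countableSubbasis D, this⟩
  have hm : USCFun.instMeasurableSpace D = .generateFrom (USCFun.countableSubbasis D) :=
    borel_eq_generateFrom_of_subbasis (USCFun.topology_eq_generateFrom D)
  rw [hm]
  refine measurable_generateFrom ?_
  rintro A (⟨V, -, q, hVc, rfl⟩ | ⟨V, hV, q, rfl⟩)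
  · exact hf _ _ hVc
  -- The complement, f ω ≤ q on V, is written with strict bounds on compact sets: countably many W
  -- exhaust V and rational r decrease to q.
  · have heq : f ⁻¹' {z | ∃ s ∈ V, ((q : ℝ) : EReal) < z s} =
        (⋂ W ∈ {W ∈ TopologicalSpace.countableBasis D | IsCompact (closure W) ∧ closure W ⊆ V},
          ⋂ r ∈ {r : ℚ | q < r}, {ω | ∀ s ∈ closure W, f ω s < ((r : ℝ) : EReal)})ᶜ := by
      ext ω
      simp only [mem_preimage, mem_ofPred_eq, mem_compl_iff, mem_iInter]
      constructor
      · rintro ⟨s, hs, hq⟩ hall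
        obtain ⟨W, hW, hsW, hWc, hWV⟩ := exists_countableBasis_closure_subset
          ((TopologicalSpace.isOpen_of_mem_countableBasis hV).mem_nhds hs)
        obtain ⟨r, hqr, hr⟩ := EReal.lt_iff_exists_rat_btwn.mp hq
        have hqr' : q < r := by exact_mod_cast EReal.coe_lt_coe_iff.mp hqr
        exact lt_asymm hr (hall W ⟨hW, hWc, hWV⟩ r hqr' s (subset_closure hsW))
      · intro h
        by_contra! hle
        refine h fun W hW r hr s hs => (hle s (hW.2.2 hs)).trans_lt ?_
        exact EReal.coe_lt_coe_iff.mpr (by exact_mod_cast hr)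
    rw [heq]
    refine (MeasurableSet.biInter (hB.mono fun W hW => hW.1) fun W hW =>
      MeasurableSet.biInter (to_countable _) fun r _ => hf _ _ hW.2.1).compl

theorem USCFun.measurableSet_le {D : Type} [TopologicalSpace D] (s : D) (x : ℝ) :
    MeasurableSet {z : USCFun D | z s ≤ x} := by
  have heq : {z : USCFun D | z s ≤ x} =
      ⋂ q ∈ {q : ℚ | x < q}, {z | ∀ t ∈ ({s} : Set D), z t < ((q : ℝ) : EReal)} := by
    ext z
    simp only [mem_ofPred_eq, mem_iInter, mem_singleton_iff, forall_eq]
    constructor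
    · exact fun h q hq => h.trans_lt (EReal.coe_lt_coe_iff.mpr hq)
    · refine fun h => le_of_not_gt fun hlt => ?_
      obtain ⟨q, hq, hqz⟩ := EReal.lt_iff_exists_rat_btwn.mp hlt
      exact lt_asymm hqz (h q (EReal.coe_lt_coe_iff.mp hq))
  rw [heq]
  exact MeasurableSet.biInter (to_countable _) fun q _ =>
    (USCFun.isOpen_forall_lt isCompact_singleton q).measurableSet

theorem USCFun.finMax_lt_iff {D : Type} [TopologicalSpace D] {n : ℕ} (z : Fin n → USCFun D)
    (s : D) (a : ℝ) : USCFun.finMax z s < a ↔ ∀ i, z i s < a := by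
  simp [USCFun.finMax, Finset.sup_lt_iff (EReal.bot_lt_coe a)]

theorem USCFun.finMax_le_iff {D : Type} [TopologicalSpace D] {n : ℕ} (z : Fin n → USCFun D)
    (s : D) (a : EReal) : USCFun.finMax z s ≤ a ↔ ∀ i, z i s ≤ a := by
  simp [USCFun.finMax]

theorem USCFun.measurable_finMax {D : Type} [TopologicalSpace D] [LocallyCompactSpace D]
    [T2Space D] [SecondCountableTopology D] (n : ℕ) :
    Measurable (USCFun.finMax : (Fin n → USCFun D) → USCFun D) := by
  refine USCFun.measurable_of_forall_lt fun K a hK => ?_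
  have heq : {z : Fin n → USCFun D | ∀ s ∈ K, USCFun.finMax z s < a} =
      ⋂ i, (fun z => z i) ⁻¹' {w : USCFun D | ∀ s ∈ K, w s < (a : EReal)} := by
    ext z
    simp only [USCFun.finMax_lt_iff, mem_ofPred_eq, mem_iInter, mem_preimage]
    exact ⟨fun h i s hs => h s hs i, fun h s hs i => h i s hs⟩
  rw [heq]
  exact MeasurableSet.iInter fun i =>
    measurable_pi_apply i (USCFun.isOpen_forall_lt hK a).measurableSet

/-! ### Pointwise quantile transformation -/

/-- Right-continuity of Φ on the extended line: p ≤ 1 excludes x = ∞, and Φ(0) = 0 provides the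
witness at -∞. -/
theorem exists_gt_unitFrechet_lt {x : EReal} {p : ℝ} (hp1 : p ≤ 1) (h : unitFrechet x < p) :
    ∃ q : ℝ, x < q ∧ unitFrechet q < p := by
  unfold unitFrechet at *
  induction x with
  | bot =>
    refine ⟨0, EReal.bot_lt_coe 0, ?_⟩
    rw [gevCDF_bot] at h
    have := unitFrechet_coe 0
    rw [unitFrechet, if_pos le_rfl] at this
    rwa [this]
  | top => rw [gevCDF_top] at h; exact absurd h (not_lt.mpr hp1)
  | coe x =>
    rw [gevCDF_coe] at h
    obtain ⟨q, hq, hxq⟩ := (((continuous_gevCDFReal unitFrechetParam).continuousAt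
      |>.continuousWithinAt.eventually (gt_mem_nhds h)).and
      (self_mem_nhdsWithin (s := Ioi x))).exists
    exact ⟨q, EReal.coe_lt_coe_iff.mpr hxq, by rwa [gevCDF_coe]⟩

/-- Supplies the hypothesis of `USCFun.isOpen_forall_rel`. The margin Φ(q) < F(a;θ(s)) persists near
s by lower semicontinuity, and monotonicity of Φ covers all y < q. -/
theorem gevQuantile_unitFrechet_lt_rel {D : Type*} [TopologicalSpace D] {θ : D → GEVParam}
    (hθ : ∀ a : ℝ, LowerSemicontinuous fun s => gevCDFReal (θ s) a) (a : ℝ) (s : D) (x : EReal)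
    (h : gevQuantile (unitFrechet x) (θ s) < a) :
    ∃ q : ℝ, x < q ∧ ∀ᶠ s' in 𝓝 s, ∀ y < (q : EReal),
      gevQuantile (unitFrechet y) (θ s') < a := by
  obtain ⟨q, hxq, hq⟩ := exists_gt_unitFrechet_lt (gevCDFReal_le_one _ _)
    ((gevQuantile_lt_coe_iff _ _ _).mp h)
  refine ⟨q, hxq, (hθ a s _ hq).mono fun s' hs' y hy => ?_⟩
  exact (gevQuantile_lt_coe_iff _ _ _).mpr ((monotone_gevCDF _ hy.le).trans_lt hs')

/-- The transformation `z ↦ Q(Φ(z(·)); θ(·))` of `USC(D)`. -/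
noncomputable def USCFun.gevTransform {D : Type} [TopologicalSpace D] (θ : D → GEVParam)
    (hθ : ∀ a : ℝ, LowerSemicontinuous fun s => gevCDFReal (θ s) a) (z : USCFun D) :
    USCFun D where
  toFun := fun s => gevQuantile (unitFrechet (z s)) (θ s)
  usc' := by
    intro s y hy
    obtain ⟨a, ha, hay⟩ := EReal.lt_iff_exists_real_btwn.mp hy
    obtain ⟨q, hq, hev⟩ := gevQuantile_unitFrechet_lt_rel hθ a s _ ha
    filter_upwards [z.usc' s q hq, hev] with s' h1 h2
    exact (h2 _ h1).trans hay

theorem USCFun.measurable_gevTransform {D : Type} [TopologicalSpace D] [LocallyCompactSpace D]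
    [T2Space D] [SecondCountableTopology D] (θ : D → GEVParam)
    (hθ : ∀ a : ℝ, LowerSemicontinuous fun s => gevCDFReal (θ s) a) :
    Measurable (USCFun.gevTransform θ hθ) :=
  USCFun.measurable_of_forall_lt fun _ a hK =>
    (USCFun.isOpen_forall_rel hK (gevQuantile_unitFrechet_lt_rel hθ a)).measurableSet

theorem USCFun.gevTransform_finMax {D : Type} [TopologicalSpace D] {θ : D → GEVParam}
    (hθ : ∀ a : ℝ, LowerSemicontinuous fun s => gevCDFReal (θ s) a) {n : ℕ} (hn : 1 ≤ n)
    (z : Fin n → USCFun D) :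
    USCFun.finMax (fun i => USCFun.gevTransform θ hθ (z i)) =
      USCFun.gevTransform θ hθ (USCFun.finMax z) := by
  refine USCFun.ext_apply fun s => ?_
  -- Nonemptiness matters: the empty maximum is -∞, while Q(0;θ) is the finite lower endpoint when γ
  -- > 0.
  have hne : (Finset.univ : Finset (Fin n)).Nonempty := ⟨⟨0, hn⟩, Finset.mem_univ _⟩
  have hmono : Monotone fun x => gevQuantile (unitFrechet x) (θ s) :=
    (monotone_gevQuantile (θ s)).comp (monotone_gevCDF _)
  change Finset.univ.sup (fun i => gevQuantile (unitFrechet (z i s)) (θ s)) =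
    gevQuantile (unitFrechet (Finset.univ.sup fun i => z i s)) (θ s)
  rw [← Finset.sup'_eq_sup hne, ← Finset.sup'_eq_sup hne]
  exact (Finset.apply_sup'_eq_sup'_comp hne (fun x => gevQuantile (unitFrechet x) (θ s))
    fun x y => hmono.map_sup x y).symm

/-! ### Margins -/

theorem exists_unitFrechet_eq {v : ℝ} (hv0 : 0 < v) (hv1 : v < 1) :
    ∃ x : ℝ, unitFrechet x = v := by
  have hlog := Real.log_neg hv0 hv1
  refine ⟨-1 / Real.log v, ?_⟩
  rw [unitFrechet_coe, if_neg (not_le.mpr (div_pos_of_neg_of_neg (by norm_num) hlog)),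
    div_div_eq_mul_div, neg_mul, one_mul, neg_div_neg_eq, div_one, Real.exp_log hv0]

/-- `Φ(X)` is uniformly distributed when `X` is unit-Fréchet. -/
theorem measure_unitFrechet_lt {Ω : Type*} [MeasurableSpace Ω] {P : Measure Ω}
    [IsProbabilityMeasure P] {X : Ω → EReal}
    (hX : ∀ x : EReal, P {ω | X ω ≤ x} = ENNReal.ofReal (unitFrechet x))
    {u : ℝ} (hu : u ≤ 1) : P {ω | unitFrechet (X ω) < u} = ENNReal.ofReal u := by
  refine le_antisymm ?_ (le_of_forall_lt fun c hc => ?_)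
  · rcases le_or_gt u 0 with h0 | h0
    · have : {ω | unitFrechet (X ω) < u} = ∅ :=
        eq_empty_of_forall_notMem fun ω hω => absurd (lt_of_lt_of_le hω h0)
          (not_lt.mpr (gevCDF_nonneg _ _))
      simp [this]
    · rcases hu.eq_or_lt with rfl | h1
      · simpa using prob_le_one
      · obtain ⟨x, rfl⟩ := exists_unitFrechet_eq h0 h1
        rw [← hX]
        refine measure_mono fun ω hω => ?_
        change X ω ≤ x
        by_contra! hlt
        exact absurd (monotone_gevCDF unitFrechetParam hlt.le) (not_le.mpr hω)
  -- The strict event contains {X ≤ x} whenever Φ(x) = v < u; letting v approach u gives the lower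
  -- bound.
  · have hcu : c.toReal < u := (ENNReal.lt_ofReal_iff_toReal_lt hc.ne_top).mp hc
    obtain ⟨v, hcv, hvu⟩ := exists_between hcu
    obtain ⟨x, rfl⟩ := exists_unitFrechet_eq (ENNReal.toReal_nonneg.trans_lt hcv)
      (hvu.trans_le hu)
    refine ((ENNReal.lt_ofReal_iff_toReal_lt hc.ne_top).mpr hcv).trans_le ?_
    rw [← hX]
    exact measure_mono fun ω hω => (monotone_gevCDF unitFrechetParam hω).trans_lt hvu

theorem measure_gevQuantile_lt {Ω : Type*} [MeasurableSpace Ω] {P : Measure Ω}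
    [IsProbabilityMeasure P] {X : Ω → EReal}
    (hX : ∀ x : EReal, P {ω | X ω ≤ x} = ENNReal.ofReal (unitFrechet x))
    (θ : GEVParam) (a : ℝ) :
    P {ω | gevQuantile (unitFrechet (X ω)) θ < a} = ENNReal.ofReal (gevCDFReal θ a) := by
  simp only [gevQuantile_lt_coe_iff]
  exact measure_unitFrechet_lt hX (gevCDFReal_le_one _ _)

/-- At real x the event lies between {Q < x} and {Q < y} for y > x, whose probabilities merge by
continuity of F; at -∞ the limit of F at the left end is used. -/
theorem measure_gevQuantile_le {Ω : Type*} [MeasurableSpace Ω] {P : Measure Ω}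
    [IsProbabilityMeasure P] {X : Ω → EReal}
    (hX : ∀ x : EReal, P {ω | X ω ≤ x} = ENNReal.ofReal (unitFrechet x))
    (θ : GEVParam) (x : EReal) :
    P {ω | gevQuantile (unitFrechet (X ω)) θ ≤ x} = ENNReal.ofReal (gevCDF θ x) := by
  have hle : ∀ y : ℝ, x < y → P {ω | gevQuantile (unitFrechet (X ω)) θ ≤ x} ≤
      ENNReal.ofReal (gevCDFReal θ y) := fun y hy => by
    rw [← measure_gevQuantile_lt hX]
    exact measure_mono fun ω hω => lt_of_le_of_lt hω hy
  induction x with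
  | top => simp [gevCDF_top]
  | bot =>
    rw [gevCDF_bot]
    exact le_antisymm (ge_of_tendsto' (ENNReal.tendsto_ofReal (tendsto_gevCDFReal_atBot θ))
      fun y => hle y (EReal.bot_lt_coe y)) (by simp)
  | coe x =>
    rw [gevCDF_coe]
    refine le_antisymm ?_ ?_
    · have ht : Filter.Tendsto (gevCDFReal θ) (𝓝[>] x) (𝓝 (gevCDFReal θ x)) :=
        (continuous_gevCDFReal θ).continuousAt.continuousWithinAt
      refine ge_of_tendsto (ENNReal.tendsto_ofReal ht) ?_
      filter_upwards [self_mem_nhdsWithin] with y hy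
      exact hle y (EReal.coe_lt_coe_iff.mpr hy)
    · rw [← measure_gevQuantile_lt hX]
      exact measure_mono (ofPred_subset_ofPred.mpr fun ω hω => hω.le)

/-- If ξ(s) < a, then ξ < a on some member of a countable neighborhood basis at s. Along the
increasing union, one fixed V n already carries outer measure above p, and its event lies in {ξ(s')
< a} for every s' in V n. -/
theorem lowerSemicontinuous_gevCDFReal_of_usc {D Ω : Type*} [TopologicalSpace D]
    [FirstCountableTopology D] [MeasurableSpace Ω] {P : Measure Ω} {θ : D → GEVParam}
    {ξ : Ω → D → EReal} (hξ : ∀ ω, UpperSemicontinuous (ξ ω)) (a : ℝ)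
    (hP : ∀ s, P {ω | ξ ω s < a} = ENNReal.ofReal (gevCDFReal (θ s) a)) :
    LowerSemicontinuous fun s => gevCDFReal (θ s) a := by
  intro s p hp
  rcases lt_or_ge p 0 with h0 | h0
  · exact Filter.Eventually.of_forall fun s' => h0.trans_le (gevCDFReal_nonneg _ _)
  obtain ⟨V, hV⟩ := (𝓝 s).exists_antitone_basis
  have hmono : Monotone fun n => {ω | ∀ s' ∈ V n, ξ ω s' < a} :=
    fun m n hmn ω hω s' hs' => hω s' (hV.antitone hmn hs')
  have hsub : {ω | ξ ω s < a} ⊆ ⋃ n, {ω | ∀ s' ∈ V n, ξ ω s' < a} := fun ω hω => by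
    obtain ⟨n, -, hn⟩ := hV.toHasBasis.mem_iff.mp (hξ ω s a hω)
    exact mem_iUnion.mpr ⟨n, hn⟩
  have hlt : ENNReal.ofReal p < ⨆ n, P {ω | ∀ s' ∈ V n, ξ ω s' < a} := by
    rw [← hmono.measure_iUnion]
    refine lt_of_lt_of_le ?_ (measure_mono hsub)
    rw [hP]
    exact (ENNReal.ofReal_lt_ofReal_iff_of_nonneg h0).mpr hp
  obtain ⟨n, hn⟩ := lt_iSup_iff.mp hlt
  filter_upwards [hV.toHasBasis.mem_of_mem trivial (i := n)] with s' hs'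
  refine (ENNReal.ofReal_lt_ofReal_iff_of_nonneg h0).mp (hn.trans_le ?_)
  rw [← hP]
  exact measure_mono fun ω hω => hω s' hs'

/-! ### Max-stability -/

theorem mul_add_le_coe_iff {a : ℝ} (ha : 0 < a) (b x : ℝ) (z : EReal) :
    (a : EReal) * z + (b : EReal) ≤ ((a * x + b : ℝ) : EReal) ↔ z ≤ (x : EReal) := by
  induction z with
  | bot => rw [EReal.coe_mul_bot_of_pos ha]; simp
  | top =>
    rw [EReal.coe_mul_top_of_pos ha, EReal.top_add_coe]
    simp only [top_le_iff, EReal.coe_ne_top]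
  | coe z => norm_cast; rw [add_le_add_iff_right, mul_le_mul_iff_right₀ ha]

/-- The zero set of Φ is (-∞,0], so y = 0 and y = -b/a force b = 0; then y = 1 gives n/a = 1. -/
theorem eq_natCast_and_eq_zero_of_unitFrechet_pow {n : ℕ} (hn : 1 ≤ n) {a b : ℝ} (ha : 0 < a)
    (h : ∀ y : ℝ, unitFrechet ((a * y + b : ℝ) : EReal) ^ n = unitFrechet (y : EReal)) :
    a = n ∧ b = 0 := by
  have hn0 : n ≠ 0 := by omega
  have hzero : ∀ x : ℝ, unitFrechet x = 0 → x ≤ 0 := by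
    intro x hx
    by_contra hx0
    rw [unitFrechet_coe, if_neg hx0] at hx
    exact (Real.exp_pos _).ne' hx
  have h0 : unitFrechet ((0 : ℝ) : EReal) = 0 := by rw [unitFrechet_coe, if_pos le_rfl]
  have hb1 : b ≤ 0 := by
    have := h 0
    rw [h0, mul_zero, zero_add] at this
    exact hzero b (pow_eq_zero_iff hn0 |>.mp this)
  have hb2 : -b / a ≤ 0 := by
    have := h (-b / a)
    rw [mul_div_cancel₀ _ ha.ne', neg_add_cancel, h0, zero_pow hn0] at this
    exact hzero _ this.symm
  have hb : b = 0 := by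
    have := (div_le_iff₀ ha).mp hb2
    linarith
  refine ⟨?_, hb⟩
  have := h 1
  rw [hb, mul_one, add_zero, unitFrechet_coe, unitFrechet_coe, if_neg (not_le.mpr ha),
    if_neg (by norm_num), ← Real.exp_nat_mul, Real.exp_eq_exp] at this
  field_simp at this
  linarith

/-- The norming functions of a simple max-stable process are `n` and `0`: the maximum of `n`
independent copies has the law of `n ξ`. -/
theorem IsSimpleMaxStable.exists_map_finMax_eq {D : Type} [TopologicalSpace D]
    {Ω : Type*} [MeasurableSpace Ω] {P : Measure Ω} [IsProbabilityMeasure P]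
    {ξ : Ω → D → EReal} (h : IsSimpleMaxStable P ξ) {n : ℕ} (hn : 1 ≤ n) :
    ∃ X Y : Ω → USCFun D, IsRandomUSC ξ X ∧
      IsRandomUSC (fun ω s => ((n : ℝ) : EReal) * ξ ω s) Y ∧
      (Measure.pi fun _ => P.map X).map (USCFun.finMax : (Fin n → USCFun D) → USCFun D) =
        P.map Y := by
  obtain ⟨a, b, ha, X, Y, hX, hY, hlaw⟩ := h.1.2 n hn
  have : IsProbabilityMeasure (P.map X) := Measure.isProbabilityMeasure_map hX.1.aemeasurable
  -- The coordinates on the product of the path laws are canonical iid copies of ξ*.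
  have hid := hlaw (Fin n → USCFun D) (Measure.pi fun _ => P.map X) (fun i z => z i)
    (fun i => measurable_pi_apply i)
    (iIndepFun_pi (X := fun _ => id) fun _ => aemeasurable_id) fun i =>
      ⟨(measurable_pi_apply i).aemeasurable, hX.1.aemeasurable,
        (measurePreserving_eval (fun _ => P.map X) i).map_eq⟩
  have hab : ∀ s, a s = n ∧ b s = 0 := by
    refine fun s => eq_natCast_and_eq_zero_of_unitFrechet_pow hn (ha s) fun y => ?_
    have hm := hid.measure_mem_eq (USCFun.measurableSet_le s (a s * y + b s))
    have h1 : (fun z : Fin n → USCFun D => USCFun.finMax fun i => z i) ⁻¹'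
        {z | z s ≤ ((a s * y + b s : ℝ) : EReal)} =
        Set.pi univ fun _ => {z : USCFun D | z s ≤ ((a s * y + b s : ℝ) : EReal)} := by
      ext z
      simp [USCFun.finMax_le_iff]
    have h2 : P.map X {z : USCFun D | z s ≤ ((a s * y + b s : ℝ) : EReal)} =
        ENNReal.ofReal (unitFrechet ((a s * y + b s : ℝ) : EReal)) := by
      rw [Measure.map_apply hX.1 (USCFun.measurableSet_le s _)]
      simpa only [preimage_ofPred_eq, hX.2, unitFrechet] using h.2 s ((a s * y + b s : ℝ) : EReal)
    have h3 : P (Y ⁻¹' {z | z s ≤ ((a s * y + b s : ℝ) : EReal)}) =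
        ENNReal.ofReal (unitFrechet (y : EReal)) := by
      simpa only [preimage_ofPred_eq, hY.2, mul_add_le_coe_iff (ha s), unitFrechet] using h.2 s (y : EReal)
    rw [h1, h3, Measure.pi_pi, Finset.prod_const, h2, Finset.card_univ, Fintype.card_fin,
      ← ENNReal.ofReal_pow (p := unitFrechet _) (gevCDF_nonneg _ _)] at hm
    exact (ENNReal.ofReal_eq_ofReal_iff (pow_nonneg (gevCDF_nonneg _ _) _)
      (gevCDF_nonneg _ _)).mp hm
  refine ⟨X, Y, hX, ⟨hY.1, fun ω s => ?_⟩, hid.map_eq⟩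
  simp only [hY.2, (hab s).1, (hab s).2, EReal.coe_zero, add_zero]

theorem isNorming_gevQuantile {D : Type} [TopologicalSpace D] [LocallyCompactSpace D]
    [T2Space D] [SecondCountableTopology D] {Ω : Type*} [MeasurableSpace Ω] {P : Measure Ω}
    [IsProbabilityMeasure P] {ξstar ξ : Ω → D → EReal} (hstar : IsSimpleMaxStable P ξstar)
    {θ : D → GEVParam} (hθ : ∀ a : ℝ, LowerSemicontinuous fun s => gevCDFReal (θ s) a)
    (hξ : ∀ ω s, ξ ω s = gevQuantile (unitFrechet (ξstar ω s)) (θ s)) {n : ℕ} (hn : 1 ≤ n) :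
    IsNorming P ξ n (fun s => gevScale n (θ s)) (fun s => gevLoc n (θ s)) := by
  obtain ⟨X, Y, hX, hY, hmap⟩ := hstar.exists_map_finMax_eq hn
  have hT := USCFun.measurable_gevTransform θ hθ
  have hM := USCFun.measurable_finMax (D := D) n
  have : IsProbabilityMeasure (P.map X) := Measure.isProbabilityMeasure_map hX.1.aemeasurable
  refine ⟨fun s => gevScale_pos hn _, fun ω => USCFun.gevTransform θ hθ (X ω),
    fun ω => USCFun.gevTransform θ hθ (Y ω), ⟨hT.comp hX.1, fun ω s => ?_⟩,
    ⟨hT.comp hY.1, fun ω s => ?_⟩, ?_⟩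
  · rw [hξ, ← hX.2]; rfl
  · simp only [hξ, gevScale_mul_gevQuantile_add_gevLoc hn]
    exact congrArg (fun x => gevQuantile (unitFrechet x) (θ s)) (hY.2 ω s)
  · intro Ω' _ P' _ X' hX' hind hid
    have hX'm : Measurable fun ω i => X' i ω := measurable_pi_lambda _ hX'
    refine ⟨(hM.comp hX'm).aemeasurable, (hT.comp hY.1).aemeasurable, ?_⟩
    have hTpi : Measurable fun (z : Fin n → USCFun D) i => USCFun.gevTransform θ hθ (z i) :=
      measurable_pi_lambda _ fun i => hT.comp (measurable_pi_apply i)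
    -- The given copies need not be transforms of copies of ξ*, but their joint law is the image of
    -- such a product law, and only laws matter.
    have hjoint : P'.map (fun ω i => X' i ω) =
        (Measure.pi fun _ : Fin n => P.map X).map
          fun z i => USCFun.gevTransform θ hθ (z i) := by
      rw [hind.map_fun_eq_pi_map fun i => (hX' i).aemeasurable,
        Measure.pi_map_pi fun _ => hT.aemeasurable]
      congr
      funext i
      rw [(hid i).map_eq, Measure.map_map hT hX.1]
      rfl
    have hcomm : USCFun.finMax ∘ (fun (z : Fin n → USCFun D) i => USCFun.gevTransform θ hθ (z i))
        = USCFun.gevTransform θ hθ ∘ USCFun.finMax :=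
      funext fun z => USCFun.gevTransform_finMax hθ hn z
    calc P'.map (fun ω => USCFun.finMax fun i => X' i ω)
        = (P'.map fun ω i => X' i ω).map USCFun.finMax := (Measure.map_map hM hX'm).symm
      _ = ((Measure.pi fun _ : Fin n => P.map X).map USCFun.finMax).map
            (USCFun.gevTransform θ hθ) := by
          rw [hjoint, Measure.map_map hM hTpi, hcomm, Measure.map_map hT hM]
      _ = P.map fun ω => USCFun.gevTransform θ hθ (Y ω) := by
          rw [hmap, Measure.map_map hT hY.1]
          rfl

theorem mainTheorem1 {d : ℕ} (D : Set (EuclideanSpace ℝ (Fin d))) (_hD : D.Nonempty)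
    [LocallyCompactSpace D]
    {Ω : Type*} [MeasurableSpace Ω] (P : Measure Ω) [IsProbabilityMeasure P]
    (ξstar : Ω → D → EReal) (hstar : IsSimpleMaxStable P ξstar)
    (θ : D → GEVParam)
    (ξ : Ω → D → EReal)
    (hξ : ∀ ω s, ξ ω s = gevQuantile (unitFrechet (ξstar ω s)) (θ s)) :
    ((IsUSCProcess ξ ∧ HasGEVMargins P ξ θ) ↔
      ∀ p ∈ Set.Icc (0 : ℝ) 1, UpperSemicontinuous (fun s : D => gevQuantile p (θ s))) ∧
    (IsUSCProcess ξ ∧ HasGEVMargins P ξ θ →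
      IsMaxStable P ξ ∧
      ∀ n : ℕ, 1 ≤ n →
        IsNorming P ξ n (fun s => gevScale n (θ s)) (fun s => gevLoc n (θ s))) := by
  -- The probabilities P[ξ(s) < a] are computed from the unit-Fréchet margins of ξ*, so usc
  -- trajectories of ξ are enough.
  have hlsc : IsUSCProcess ξ → ∀ a : ℝ, LowerSemicontinuous fun s => gevCDFReal (θ s) a := by
    rintro ⟨X, -, hX⟩ a
    refine lowerSemicontinuous_gevCDFReal_of_usc (P := P) (ξ := ξ) (fun ω => ?_) a fun s => ?_
    · rw [← funext (hX ω)]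
      exact (X ω).usc'
    · simp only [hξ]
      exact measure_gevQuantile_lt (hstar.2 s) (θ s) a
  refine ⟨⟨fun h => (upperSemicontinuous_gevQuantile_iff θ).mpr (hlsc h.1), fun h => ?_⟩,
    fun h => ?_⟩
  · have hθ := (upperSemicontinuous_gevQuantile_iff θ).mp h
    obtain ⟨X, hXm, hX⟩ := hstar.1.1
    refine ⟨⟨fun ω => USCFun.gevTransform θ hθ (X ω),
      (USCFun.measurable_gevTransform θ hθ).comp hXm, fun ω s => ?_⟩, fun s x => ?_⟩
    · rw [hξ, ← hX]; rfl
    · simp only [hξ]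
      exact measure_gevQuantile_le (hstar.2 s) (θ s) x
  · have hnorm := fun n (hn : 1 ≤ n) => isNorming_gevQuantile hstar (hlsc h.1) hξ hn
    exact ⟨⟨h.1, fun n hn => ⟨_, _, hnorm n hn⟩⟩, hnorm⟩
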